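/- Let $A_0, A_1,\dots,A_m$ be real symmetric $n\times n$ matrices, $b\in\mathbb R^m$, $K=\{1,\dots,m\}$, $A\bullet B=\sum_{i,j}A_{ij}B_{ij}$, and let $\mathbb S^n$ and $\mathbb S^n_+$ be the sets of symmetric and of positive semidefinite $n\times n$ matrices. Consider $$\text{(P)}\ \sup_{y,Z}\Big\{b^Ty : A_0-\sum_{k\in K}y_kA_k=Z,\ y\in\mathbb R^m,\ Z\in\mathbb S^n_+\Big\},\qquad \text{(D)}\ \inf_X\{A_0\bullet X : A_k\bullet X=b_k\ (k\in K),\ X\in\mathbb S^n_+\},$$ and, for $t\ge 0$, the perturbed problem $$(\mathrm D_t)\ \inf_X\{A_0\bullet X : (A_k+E_k(t))\bullet X=b_k\ (k\in K),\ X\in\mathbb S^n_+\},$$ where each $E_k:[0,\infty)\to\mathbb S^n$ is continuous at $t=0$ and $E_k(0)=O$. A face of a convex set $C$ is a convex subset $F\subseteq C$ such that, whenever $x_1,x_2\in C$ and the open segment $(x_1,x_2)$ meets $F$, both $x_1,x_2\in F$. The minimal face of (D), or of $(\mathrm D_t)$, is the intersection of all faces of $\mathbb S^n_+$ that contain its feasible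 region; let $F_{\min}$ be the minimal face of (D). For $F\subseteq\mathbb S^n$ let $F^\perp=\{Z\in\mathbb S^n : Z\bullet X=0\ \forall X\in F\}$. A reducing certificate for a face $F$ is a triple $(y,U,V)\in\mathbb R^m\times\mathbb S^n_+\times F^\perp$ with $b^Ty=0$, $-\sum_{k\in K}y_kA_k=U+V$ and $U+V\notin F^\perp$. A facial reduction sequence for (D) is a finite sequence $(\hat y^i,\widehat U^i,\widehat V^i)_{i=1}^s$ such that, with $F_0=\mathbb S^n_+$ and $F_i=F_{i-1}\cap\{\widehat U^i\}^\perp$, each $(\hat y^i,\widehat U^i,\widehat V^i)$ is a reducing certificate for $F_{i-1}$, and $F_s=F_{\min}$. **Proposition 4.1.** Let $(\hat y^i,\widehat U^i,\widehat V^i)_{i=1}^s$ be a facial reduction sequence for (D) and $\hat K=\{k\in K : \hat y^i_k=0\ (\forall i=1,\dots,s)\}$. Suppose that 1. (D) is feasible, and (P) is strictly feasible (it has a feasible $(y,Z)$ with $Z$ positive definite); 2. $A_1,\dots,A_m$ are linearly independent; 3. $(\mathrm D_t)$ is feasible for all sufficiently small $t>0$; 4. (rank condition) there are $0\le r\le n$,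 an orthogonal matrix $Q$ with $F_{\min}=\Big\{Q\begin{pmatrix}O&O\\O&X\end{pmatrix}Q^T : X\in\mathbb S^r_+\Big\}$ and $\delta>0$ such that, for all $0\le t\le\delta$, the linear spans of $\{(Q^T(A_k+E_k(t))Q)_3 : k\in K\}$ and of $\{(Q^TA_kQ)_3 : k\in K\}$ have the same dimension, where $M_3$ denotes the right bottom $r\times r$ block of $M$; 5. $E_k(t)=O$ for all $k\notin\hat K$ and all $t\ge 0$. Then the minimal face of $(\mathrm D_t)$ is equal to $F_{\min}$ for all sufficiently small $t>0$. -/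

import Mathlib

open Filter Topology Matrix

namespace SDPFace

/-- `A • B = ∑ i j, A i j * B i j` for real `n × n` matrices. -/
def dot {n : ℕ} (A B : Matrix (Fin n) (Fin n) ℝ) : ℝ :=
  ∑ i, ∑ j, A i j * B i j

/-- The cone of (symmetric) positive semidefinite `n × n` matrices. -/
def psdCone (n : ℕ) : Set (Matrix (Fin n) (Fin n) ℝ) :=
  {X | X.PosSemidef}

/-- The set of symmetric matrices `Z` with `Z • X = 0` for all `X ∈ F`. -/
def perp {n : ℕ} (F : Set (Matrix (Fin n) (Fin n) ℝ)) : Set (Matrix (Fin n) (Fin n) ℝ) :=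
  {Z | Z.IsSymm ∧ ∀ X ∈ F, dot Z X = 0}

/-- A face of a convex set `C`: a convex subset `F` of `C` such that, whenever the open segment
between two points of `C` meets `F`, both points lie in `F`. -/
def IsFace {E : Type*} [AddCommGroup E] [Module ℝ E] (C F : Set E) : Prop :=
  Convex ℝ F ∧ F ⊆ C ∧
    ∀ x₁ ∈ C, ∀ x₂ ∈ C, (openSegment ℝ x₁ x₂ ∩ F).Nonempty → x₁ ∈ F ∧ x₂ ∈ F

/-- The minimal face of `C` containing `S`: the intersection of all faces of `C` containing `S`. -/
def minimalFace {E : Type*} [AddCommGroup E] [Module ℝ E] (C S : Set E) : Set E :=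
  ⋂₀ {F | IsFace C F ∧ S ⊆ F}

/-- The feasible region of the dual problem
`inf {A₀ • X : A_k • X = b_k for all k, X positive semidefinite}`. -/
def dualFeasible {n m : ℕ} (A : Fin m → Matrix (Fin n) (Fin n) ℝ) (b : Fin m → ℝ) :
    Set (Matrix (Fin n) (Fin n) ℝ) :=
  {X | X ∈ psdCone n ∧ ∀ k, dot (A k) X = b k}

/-- Strict feasibility of the primal problem
`sup {bᵀ y : A₀ - ∑ k, y_k A_k = Z, Z positive semidefinite}`. -/
def PrimalStrictlyFeasible {n m : ℕ} (A₀ : Matrix (Fin n) (Fin n) ℝ)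
    (A : Fin m → Matrix (Fin n) (Fin n) ℝ) : Prop :=
  ∃ y : Fin m → ℝ, ∃ Z : Matrix (Fin n) (Fin n) ℝ, A₀ - ∑ k, y k • A k = Z ∧ Z.PosDef

/-- The minimal face of the dual problem: the minimal face of the positive semidefinite cone that
contains the feasible region. -/
def dualMinimalFace {n m : ℕ} (A : Fin m → Matrix (Fin n) (Fin n) ℝ) (b : Fin m → ℝ) :
    Set (Matrix (Fin n) (Fin n) ℝ) :=
  minimalFace (psdCone n) (dualFeasible A b)

/-- `(y, U, V)` is a reducing certificate for the face `F`, that is, a solution of the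
discriminant system. -/
def IsReducingCertificate {n m : ℕ} (A : Fin m → Matrix (Fin n) (Fin n) ℝ) (b : Fin m → ℝ)
    (F : Set (Matrix (Fin n) (Fin n) ℝ))
    (y : Fin m → ℝ) (U V : Matrix (Fin n) (Fin n) ℝ) : Prop :=
  U ∈ psdCone n ∧ V ∈ perp F ∧
    ∑ k, b k * y k = 0 ∧ -∑ k, y k • A k = U + V ∧ U + V ∉ perp F

/-- `(y i, U i, V i)`, for `i = 0, …, s - 1`, is a facial reduction sequence for the dual problem:
it starts from the whole cone, each triple is a reducing certificate for the current face `F`,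
which it replaces by `F ∩ {U i}^⊥`, and the last face is the minimal face. -/
def IsFacialReductionSequence {n m : ℕ} (A : Fin m → Matrix (Fin n) (Fin n) ℝ) (b : Fin m → ℝ)
    (s : ℕ) (y : Fin s → Fin m → ℝ) (U V : Fin s → Matrix (Fin n) (Fin n) ℝ) : Prop :=
  ∃ F : Fin (s + 1) → Set (Matrix (Fin n) (Fin n) ℝ),
    F 0 = psdCone n ∧
    (∀ i : Fin s, IsReducingCertificate A b (F i.castSucc) (y i) (U i) (V i)) ∧
    (∀ i : Fin s, F i.succ = F i.castSucc ∩ perp {U i}) ∧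
    F (Fin.last s) = dualMinimalFace A b

/-- The index set `{0, …, n - 1}` split into its first `p` and its last `r` elements, where
`p + r = n`. -/
def splitIndex {p r n : ℕ} (h : p + r = n) : Fin p ⊕ Fin r ≃ Fin n :=
  finSumFinEquiv.trans (finCongr h)

/-- The right bottom `r × r` block `M₃` of an `n × n` matrix `M`. -/
def lowerRight {p r n : ℕ} (h : p + r = n) (M : Matrix (Fin n) (Fin n) ℝ) :
    Matrix (Fin r) (Fin r) ℝ :=
  (M.submatrix (splitIndex h) (splitIndex h)).toBlocks₂₂

/-- The `n × n` matrix whose right bottom block is `X` and whose other blocks are zero. -/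
def padLowerRight {p r n : ℕ} (h : p + r = n) (X : Matrix (Fin r) (Fin r) ℝ) :
    Matrix (Fin n) (Fin n) ℝ :=
  (Matrix.fromBlocks 0 0 0 X).submatrix (splitIndex h).symm (splitIndex h).symm

/-- The rank condition for the perturbation `A k + E k t` of the dual problem, where `Q` is an
orthogonal matrix that brings the minimal face of the unperturbed problem into block form. -/
def RankCondition {n m : ℕ} (A : Fin m → Matrix (Fin n) (Fin n) ℝ) (b : Fin m → ℝ)
    (E : Fin m → ℝ → Matrix (Fin n) (Fin n) ℝ) : Prop :=
  ∃ (p r : ℕ) (h : p + r = n) (Q : Matrix (Fin n) (Fin n) ℝ),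
    Q ∈ Matrix.orthogonalGroup (Fin n) ℝ ∧
    dualMinimalFace A b = {M | ∃ X ∈ psdCone r, M = Q * padLowerRight h X * Qᵀ} ∧
    ∃ δ > 0, ∀ t : ℝ, 0 ≤ t → t ≤ δ →
      Module.finrank ℝ
          (Submodule.span ℝ (Set.range fun k => lowerRight h (Qᵀ * (A k + E k t) * Q))) =
        Module.finrank ℝ
          (Submodule.span ℝ (Set.range fun k => lowerRight h (Qᵀ * A k * Q)))

end SDPFace

open SDPFace

namespace SDPFace

/-! For small `t` the two minimal faces contain each other. The facial reduction sequence uses only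
`y i k • A k`, and `E k t` vanishes wherever some `y i k` is nonzero; the same certificates
therefore confine the perturbed feasible region to the unperturbed minimal face
(`dualFeasible_subset_of_facialReduction`).

For the reverse inclusion, restrict to that face, a copy of the `r × r` cone. A feasible point is
there positive definite (`exists_posDef_feasible`). The restricted linear system stays consistent
with constant rank, so this point extends to nearby solutions of the perturbed systems
(`exists_tendsto_solution`), still positive definite since that condition is open. A face through
such a point contains the whole copy of the cone (`image_faceMap_subset_of_posDef_mem`). -/

/-- The pairing `dot` as a bilinear map. -/
def dotBilin (n : ℕ) :
    Matrix (Fin n) (Fin n) ℝ →ₗ[ℝ] Matrix (Fin n) (Fin n) ℝ →ₗ[ℝ] ℝ :=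
  LinearMap.mk₂ ℝ dot
    (fun A A' B => by simp [dot, add_mul, Finset.sum_add_distrib])
    (fun c A B => by simp [dot, Finset.mul_sum, mul_assoc])
    (fun A B B' => by simp [dot, mul_add, Finset.sum_add_distrib])
    (fun c A B => by simp [dot, Finset.mul_sum, mul_left_comm])

lemma dotBilin_apply {n : ℕ} (A B : Matrix (Fin n) (Fin n) ℝ) : dotBilin n A B = dot A B := rfl

lemma dot_comm {n : ℕ} (A B : Matrix (Fin n) (Fin n) ℝ) : dot A B = dot B A := by
  simp [dot, mul_comm]

lemma dot_self_eq_zero {n : ℕ} {A : Matrix (Fin n) (Fin n) ℝ} (h : dot A A = 0) : A = 0 := by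
  ext i j
  have h1 := (Finset.sum_eq_zero_iff_of_nonneg
    (fun i _ => Finset.sum_nonneg fun j _ => mul_self_nonneg (A i j))).1 h i (Finset.mem_univ _)
  have h2 := (Finset.sum_eq_zero_iff_of_nonneg
    (fun j _ => mul_self_nonneg (A i j))).1 h1 j (Finset.mem_univ _)
  simpa using h2

lemma dot_eq_trace {n : ℕ} (A B : Matrix (Fin n) (Fin n) ℝ) : dot A B = (A * Bᵀ).trace := by
  simp [dot, Matrix.trace, Matrix.mul_apply]

lemma dot_conj {n : ℕ} (A P Q : Matrix (Fin n) (Fin n) ℝ) :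
    dot A (Q * P * Qᵀ) = dot (Qᵀ * A * Q) P := by
  rw [dot_eq_trace, dot_eq_trace, Matrix.mul_assoc (Qᵀ), Matrix.mul_assoc (Qᵀ),
    Matrix.trace_mul_comm Qᵀ]
  simp [Matrix.mul_assoc]

lemma tendsto_dot {n : ℕ} {α : Type*} {l : Filter α} {f g : α → Matrix (Fin n) (Fin n) ℝ}
    {A B : Matrix (Fin n) (Fin n) ℝ} (hf : Tendsto f l (𝓝 A)) (hg : Tendsto g l (𝓝 B)) :
    Tendsto (fun t => dot (f t) (g t)) l (𝓝 (dot A B)) :=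
  tendsto_finsetSum _ fun i _ => tendsto_finsetSum _ fun j _ =>
    (tendsto_pi_nhds.1 (tendsto_pi_nhds.1 hf i) j).mul
      (tendsto_pi_nhds.1 (tendsto_pi_nhds.1 hg i) j)

lemma isSymm_of_isHermitian {n : ℕ} {X : Matrix (Fin n) (Fin n) ℝ} (hX : X.IsHermitian) :
    X.IsSymm := by
  rw [Matrix.IsSymm, ← Matrix.conjTranspose_eq_transpose_of_trivial, hX.eq]

/-! ### Block matrices and coordinates on a face -/

section Blocks

variable {p r n : ℕ} (h : p + r = n)

lemma dot_padLowerRight (B : Matrix (Fin n) (Fin n) ℝ) (X : Matrix (Fin r) (Fin r) ℝ) :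
    dot B (padLowerRight h X) = dot (lowerRight h B) X := by
  unfold dot
  rw [← (splitIndex h).sum_comp]
  simp_rw [← (splitIndex h).sum_comp (fun j => B _ j * _)]
  simp [padLowerRight, lowerRight, Matrix.toBlocks₂₂]

lemma lowerRight_padLowerRight (X : Matrix (Fin r) (Fin r) ℝ) :
    lowerRight h (padLowerRight h X) = X := by
  ext i j
  simp [padLowerRight, lowerRight, Matrix.toBlocks₂₂]

lemma continuous_lowerRight :
    Continuous (lowerRight h : Matrix (Fin n) (Fin n) ℝ → Matrix (Fin r) (Fin r) ℝ) := by
  unfold lowerRight Matrix.toBlocks₂₂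
  fun_prop

lemma isSymm_lowerRight {B : Matrix (Fin n) (Fin n) ℝ} (hB : B.IsSymm) :
    (lowerRight h B).IsSymm := by
  ext i j
  simp [lowerRight, Matrix.toBlocks₂₂, hB.apply]

lemma posSemidef_lowerRight {B : Matrix (Fin n) (Fin n) ℝ} (hB : B.PosSemidef) :
    (lowerRight h B).PosSemidef :=
  hB.submatrix fun i => splitIndex h (Sum.inr i)

lemma lowerRight_add (B C : Matrix (Fin n) (Fin n) ℝ) :
    lowerRight h (B + C) = lowerRight h B + lowerRight h C := rfl

lemma lowerRight_smul (c : ℝ) (B : Matrix (Fin n) (Fin n) ℝ) :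
    lowerRight h (c • B) = c • lowerRight h B := rfl

lemma posSemidef_padLowerRight {X : Matrix (Fin r) (Fin r) ℝ} (hX : X.PosSemidef) :
    (padLowerRight h X).PosSemidef := by
  refine PosSemidef.submatrix ?_ _
  refine PosSemidef.of_dotProduct_mulVec_nonneg ?_ fun x => ?_
  · rw [Matrix.IsHermitian, Matrix.fromBlocks_conjTranspose, hX.isHermitian.eq]
    simp
  · simpa [Matrix.fromBlocks_mulVec, dotProduct] using
      hX.dotProduct_mulVec_nonneg (x ∘ Sum.inr)

/-- The linear map `X ↦ Q * padLowerRight X * Qᵀ` that parametrizes a face of the positive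
semidefinite cone by smaller matrices. -/
def faceMap (Q : Matrix (Fin n) (Fin n) ℝ) :
    Matrix (Fin r) (Fin r) ℝ →ₗ[ℝ] Matrix (Fin n) (Fin n) ℝ where
  toFun X := Q * padLowerRight h X * Qᵀ
  map_add' X Y := by
    rw [← Matrix.add_mul, ← Matrix.mul_add]
    congr 2
    ext i j
    simp only [padLowerRight, Matrix.submatrix_apply, Matrix.add_apply]
    rcases (splitIndex h).symm i with a | a <;> rcases (splitIndex h).symm j with b | b <;> simp
  map_smul' c X := by
    rw [RingHom.id_apply, ← Matrix.smul_mul, ← Matrix.mul_smul]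
    congr 2
    ext i j
    simp only [padLowerRight, Matrix.submatrix_apply, Matrix.smul_apply]
    rcases (splitIndex h).symm i with a | a <;> rcases (splitIndex h).symm j with b | b <;> simp

lemma faceMap_apply (Q : Matrix (Fin n) (Fin n) ℝ) (X : Matrix (Fin r) (Fin r) ℝ) :
    faceMap h Q X = Q * padLowerRight h X * Qᵀ := rfl

/-- Adjointness: on the face, a constraint sees only the bottom right block of its coefficient
matrix. -/
lemma dot_faceMap (A Q : Matrix (Fin n) (Fin n) ℝ) (X : Matrix (Fin r) (Fin r) ℝ) :
    dot A (faceMap h Q X) = dot (lowerRight h (Qᵀ * A * Q)) X := by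
  rw [faceMap_apply, dot_conj, dot_padLowerRight]

lemma posSemidef_faceMap (Q : Matrix (Fin n) (Fin n) ℝ) {X : Matrix (Fin r) (Fin r) ℝ}
    (hX : X.PosSemidef) : (faceMap h Q X).PosSemidef := by
  have := (posSemidef_padLowerRight h hX).mul_mul_conjTranspose_same Q
  rwa [Matrix.conjTranspose_eq_transpose_of_trivial] at this

lemma lowerRight_faceMap {Q : Matrix (Fin n) (Fin n) ℝ}
    (hQ : Q ∈ Matrix.orthogonalGroup (Fin n) ℝ) (X : Matrix (Fin r) (Fin r) ℝ) :
    lowerRight h (Qᵀ * faceMap h Q X * Q) = X := by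
  have hQ' : Qᵀ * Q = 1 := (Matrix.mem_orthogonalGroup_iff' _ _).1 hQ
  have : Qᵀ * faceMap h Q X * Q = (Qᵀ * Q) * padLowerRight h X * (Qᵀ * Q) := by
    simp only [faceMap_apply, Matrix.mul_assoc]
  rw [this, hQ', Matrix.one_mul, Matrix.mul_one, lowerRight_padLowerRight]

end Blocks

/-! ### Faces of convex sets -/

section Faces

variable {E : Type*} [AddCommGroup E] [Module ℝ E]

lemma isFace_self {C : Set E} (hC : Convex ℝ C) : IsFace C C :=
  ⟨hC, subset_rfl, fun _ h₁ _ h₂ _ => ⟨h₁, h₂⟩⟩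

lemma isFace_inter_ker {C : Set E} (hC : Convex ℝ C) (f : E →ₗ[ℝ] ℝ) (hf : ∀ x ∈ C, 0 ≤ f x) :
    IsFace C {x | x ∈ C ∧ f x = 0} := by
  refine ⟨?_, fun x hx => hx.1, ?_⟩
  · intro x hx z hz a c ha hc hac
    exact ⟨hC hx.1 hz.1 ha hc hac, by simp [hx.2, hz.2]⟩
  · rintro x₁ h₁ x₂ h₂ ⟨_, ⟨a, c, ha, hc, -, rfl⟩, hx⟩
    have h := hx.2
    simp only [map_add, map_smul, smul_eq_mul] at h
    have g₁ := mul_nonneg ha.le (hf x₁ h₁)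
    have g₂ := mul_nonneg hc.le (hf x₂ h₂)
    refine ⟨⟨h₁, ?_⟩, h₂, ?_⟩
    · exact (mul_eq_zero.1 (by linarith : a * f x₁ = 0)).resolve_left ha.ne'
    · exact (mul_eq_zero.1 (by linarith : c * f x₂ = 0)).resolve_left hc.ne'

lemma subset_minimalFace (C S : Set E) : S ⊆ minimalFace C S :=
  Set.subset_sInter fun _ hF => hF.2

lemma minimalFace_subset {C S F : Set E} (hF : IsFace C F) (hS : S ⊆ F) :
    minimalFace C S ⊆ F :=
  Set.sInter_subset_of_mem ⟨hF, hS⟩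

lemma isFace_minimalFace {C S : Set E} (hC : Convex ℝ C) (hS : S ⊆ C) :
    IsFace C (minimalFace C S) := by
  refine ⟨convex_sInter fun F hF => hF.1.1, minimalFace_subset (isFace_self hC) hS, ?_⟩
  rintro x₁ h₁ x₂ h₂ ⟨x, hx, hx'⟩
  exact ⟨Set.mem_sInter.2 fun F hF => (hF.1.2.2 x₁ h₁ x₂ h₂ ⟨x, hx, hx' F hF⟩).1,
    Set.mem_sInter.2 fun F hF => (hF.1.2.2 x₁ h₁ x₂ h₂ ⟨x, hx, hx' F hF⟩).2⟩

end Faces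

/-! ### Quadratic forms and positive definiteness -/

lemma convex_psdCone (n : ℕ) : Convex ℝ (psdCone n) := fun _ hX _ hY _ _ ha hc _ =>
  (PosSemidef.smul hX ha).add (PosSemidef.smul hY hc)

/-- The quadratic form of the matrix `X` at the vector `v`, as a linear function of `X`. -/
def quadForm {n : ℕ} (v : Fin n → ℝ) : Matrix (Fin n) (Fin n) ℝ →ₗ[ℝ] ℝ where
  toFun X := v ⬝ᵥ (X *ᵥ v)
  map_add' X Y := by simp [Matrix.add_mulVec, dotProduct_add]
  map_smul' c X := by simp [Matrix.smul_mulVec, dotProduct_smul]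

lemma quadForm_apply {n : ℕ} (v : Fin n → ℝ) (X : Matrix (Fin n) (Fin n) ℝ) :
    quadForm v X = v ⬝ᵥ (X *ᵥ v) := rfl

lemma quadForm_nonneg {n : ℕ} (v : Fin n → ℝ) {X : Matrix (Fin n) (Fin n) ℝ}
    (hX : X.PosSemidef) : 0 ≤ quadForm v X := by
  simpa [quadForm_apply] using hX.dotProduct_mulVec_nonneg v

lemma mulVec_eq_zero_of_quadForm_eq_zero {n : ℕ} {v : Fin n → ℝ}
    {X : Matrix (Fin n) (Fin n) ℝ} (hX : X.PosSemidef) (h : quadForm v X = 0) :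
    X *ᵥ v = 0 := by
  refine (hX.dotProduct_mulVec_zero_iff v).1 ?_
  simpa [quadForm_apply] using h

/-- Positive definiteness is an open condition within the symmetric matrices. -/
lemma eventually_posDef {n : ℕ} {X : Matrix (Fin n) (Fin n) ℝ} (hX : X.PosDef) :
    ∀ᶠ Y in 𝓝 X, Y.IsSymm → Y.PosDef := by
  have hK := isCompact_sphere (0 : Fin n → ℝ) 1
  -- Positivity at each pair `(X, v)` spreads to a neighbourhood; compactness of the sphere makes it
  -- uniform in `v`.
  have key : ∀ᶠ Y in 𝓝 X, ∀ v ∈ Metric.sphere (0 : Fin n → ℝ) 1, 0 < v ⬝ᵥ (Y *ᵥ v) := by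
    refine hK.eventually_forall_of_forall_eventually fun v hv => ?_
    have hc : Continuous fun z : Matrix (Fin n) (Fin n) ℝ × (Fin n → ℝ) =>
        z.2 ⬝ᵥ (z.1 *ᵥ z.2) := by fun_prop
    refine hc.continuousAt.eventually (lt_mem_nhds ?_)
    have hv0 : v ≠ 0 := by
      rintro rfl
      simp at hv
    simpa using hX.dotProduct_mulVec_pos hv0
  filter_upwards [key] with Y hY hs
  refine PosDef.of_dotProduct_mulVec_pos (by simpa [Matrix.IsHermitian] using hs.eq) fun x hx => ?_
  have h1 := hY (‖x‖⁻¹ • x) (by simp [norm_smul, norm_ne_zero_iff.2 hx])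
  rw [Matrix.mulVec_smul, dotProduct_smul, smul_dotProduct, smul_smul, smul_eq_mul] at h1
  have h2 : 0 < ‖x‖⁻¹ * ‖x‖⁻¹ := by positivity
  simpa using (mul_pos_iff_of_pos_left h2).1 h1

/-! ### Perturbed linear systems of constant rank -/

/-- The Gram matrix of a family of matrices with respect to `dot`. -/
def dotGram {r : ℕ} {κ : Type*} (a : κ → Matrix (Fin r) (Fin r) ℝ) : Matrix κ κ ℝ :=
  Matrix.of fun i j => dot (a i) (a j)

lemma dotGram_mulVec {r : ℕ} {κ : Type*} [Fintype κ] (a : κ → Matrix (Fin r) (Fin r) ℝ)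
    (c : κ → ℝ) (i : κ) : (dotGram a *ᵥ c) i = dot (a i) (∑ j, c j • a j) := by
  simp [← dotBilin_apply, dotGram, Matrix.mulVec, dotProduct, mul_comm]

/-- A kernel vector `c` of the Gram matrix makes `∑ j, c j • a j` orthogonal to itself, hence zero.
Independence thus becomes an open condition on a determinant. -/
lemma det_dotGram_ne_zero_iff {r : ℕ} {κ : Type*} [Fintype κ] [DecidableEq κ]
    (a : κ → Matrix (Fin r) (Fin r) ℝ) :
    (dotGram a).det ≠ 0 ↔ LinearIndependent ℝ a := by
  rw [Ne, ← Matrix.exists_mulVec_eq_zero_iff, Fintype.linearIndependent_iff]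
  push Not
  have key : ∀ c : κ → ℝ, dotGram a *ᵥ c = 0 ↔ ∑ j, c j • a j = 0 := by
    intro c
    constructor
    · intro h
      apply dot_self_eq_zero
      have : ∀ B, dot (∑ j, c j • a j) B = ∑ j, c j * dot (a j) B := by
        intro B
        simp [← dotBilin_apply]
      rw [this]
      simp [← dotGram_mulVec, h]
    · intro h
      ext i
      rw [dotGram_mulVec, h, ← dotBilin_apply, map_zero]
      rfl
  constructor
  · intro h c hc i
    by_contra hi
    exact h c (fun h0 => hi (by simp [h0])) ((key c).2 hc)
  · intro h c hc h0
    exact hc (funext (h c ((key c).1 h0)))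

lemma tendsto_mulVec {α κ : Type*} [Fintype κ] {l : Filter α} {M : α → Matrix κ κ ℝ}
    {v : α → κ → ℝ} {M₀ : Matrix κ κ ℝ} {v₀ : κ → ℝ} (hM : Tendsto M l (𝓝 M₀))
    (hv : Tendsto v l (𝓝 v₀)) : Tendsto (fun t => M t *ᵥ v t) l (𝓝 (M₀ *ᵥ v₀)) :=
  tendsto_pi_nhds.2 fun i => tendsto_finsetSum _ fun j _ =>
    (tendsto_pi_nhds.1 (tendsto_pi_nhds.1 hM i) j).mul (tendsto_pi_nhds.1 hv j)

/-- A solution of a linear system persists, nearby, under perturbations of the coefficients that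
keep the system consistent and its rank constant. -/
lemma exists_tendsto_solution {r : ℕ} {ι α : Type*} {l : Filter α} [Finite ι]
    (a : α → ι → Matrix (Fin r) (Fin r) ℝ) (a₀ : ι → Matrix (Fin r) (Fin r) ℝ) (b : ι → ℝ)
    (ha : ∀ k, Tendsto (fun t => a t k) l (𝓝 (a₀ k)))
    (hrank : ∀ᶠ t in l, Module.finrank ℝ (Submodule.span ℝ (Set.range (a t))) =
      Module.finrank ℝ (Submodule.span ℝ (Set.range a₀)))
    (hcons : ∀ᶠ t in l, ∃ X, ∀ k, dot (a t k) X = b k)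
    (X₀ : Matrix (Fin r) (Fin r) ℝ) (hX₀ : ∀ k, dot (a₀ k) X₀ = b k) :
    ∃ x : α → Matrix (Fin r) (Fin r) ℝ, Tendsto x l (𝓝 X₀) ∧
      (∀ t, x t - X₀ ∈ Submodule.span ℝ (Set.range (a t))) ∧
      ∀ᶠ t in l, ∀ k, dot (a t k) (x t) = b k := by
  classical
  -- Keep an independent subfamily with the same span as `a₀`; the system is first solved on it.
  obtain ⟨κ, J, hJ, hspan, hli⟩ := exists_linearIndependent' ℝ a₀
  have : Finite κ := Finite.of_injective J hJ
  cases nonempty_fintype κ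
  have hG : Tendsto (fun t => dotGram (a t ∘ J)) l (𝓝 (dotGram (a₀ ∘ J))) := by
    refine tendsto_pi_nhds.2 fun i => tendsto_pi_nhds.2 fun j => ?_
    exact tendsto_dot (ha (J i)) (ha (J j))
  have hdet₀ := (det_dotGram_ne_zero_iff _).2 hli
  have hdet : Tendsto (fun t => (dotGram (a t ∘ J)).det) l (𝓝 (dotGram (a₀ ∘ J)).det) :=
    ((continuous_id.matrix_det).tendsto _).comp hG
  have hGinv : Tendsto (fun t => (dotGram (a t ∘ J))⁻¹) l (𝓝 (dotGram (a₀ ∘ J))⁻¹) := by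
    simp_rw [Matrix.inv_def, Ring.inverse_eq_inv']
    exact (hdet.inv₀ hdet₀).smul (((continuous_id.matrix_adjugate).tendsto _).comp hG)
  let d : α → κ → ℝ := fun t i => b (J i) - dot (a t (J i)) X₀
  have hd : Tendsto d l (𝓝 0) := by
    refine tendsto_pi_nhds.2 fun i => ?_
    have h1 : Tendsto (fun t => dot (a t (J i)) X₀) l (𝓝 (dot (a₀ (J i)) X₀)) :=
      tendsto_dot (ha (J i)) tendsto_const_nhds
    have h2 := (tendsto_const_nhds (x := b (J i))).sub h1
    rwa [hX₀, sub_self] at h2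
  -- Coefficients of the correction to `X₀` that cancels the residual `d t` on the selected
  -- equations; they tend to zero with it.
  let c : α → κ → ℝ := fun t => (dotGram (a t ∘ J))⁻¹ *ᵥ d t
  have hc : Tendsto c l (𝓝 0) := by
    have := tendsto_mulVec hGinv hd
    rwa [Matrix.mulVec_zero] at this
  refine ⟨fun t => X₀ + ∑ j, c t j • a t (J j), ?_, ?_, ?_⟩
  · have : Tendsto (fun t => ∑ j, c t j • a t (J j)) l (𝓝 (∑ j, (0 : ℝ) • a₀ (J j))) :=
      tendsto_finsetSum _ fun j _ => (tendsto_pi_nhds.1 hc j).smul (ha (J j))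
    simpa using (tendsto_const_nhds (x := X₀)).add this
  · intro t
    rw [add_sub_cancel_left]
    exact Submodule.sum_mem _ fun j _ =>
      Submodule.smul_mem _ _ (Submodule.subset_span ⟨J j, rfl⟩)
  · filter_upwards [hdet.eventually_ne hdet₀, hrank, hcons] with t hdt hrk ⟨X, hX⟩
    have hlit := (det_dotGram_ne_zero_iff _).1 hdt
    have hle : Submodule.span ℝ (Set.range (a t ∘ J)) ≤ Submodule.span ℝ (Set.range (a t)) :=
      Submodule.span_mono (Set.range_comp_subset_range _ _)
    -- The selected family stays independent, so by constant rank it still spans.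
    have hst : Submodule.span ℝ (Set.range (a t ∘ J)) = Submodule.span ℝ (Set.range (a t)) := by
      refine Submodule.eq_of_le_of_finrank_eq hle ?_
      rw [hrk, ← hspan, finrank_span_eq_card hlit, finrank_span_eq_card hli]
    have hsol : ∀ j, dot (a t (J j)) (X₀ + ∑ j, c t j • a t (J j)) = b (J j) := by
      intro j
      have h1 : dotGram (a t ∘ J) *ᵥ c t = d t := by
        simp only [c]
        rw [Matrix.mulVec_mulVec, Matrix.mul_nonsing_inv _ (isUnit_iff_ne_zero.2 hdt),
          Matrix.one_mulVec]
      have h2 := congrFun h1 j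
      rw [dotGram_mulVec] at h2
      have h3 : dot (a t (J j)) (X₀ + ∑ j, c t j • a t (J j)) =
          dot (a t (J j)) X₀ + dot (a t (J j)) (∑ j, c t j • a t (J j)) := by
        simp only [← dotBilin_apply, map_add]
      rw [h3]
      simp only [Function.comp_apply, d] at h2
      rw [h2]
      ring
    intro k
    have hk : a t k ∈ Submodule.span ℝ (Set.range (a t ∘ J)) :=
      hst ▸ Submodule.subset_span ⟨k, rfl⟩
    -- The corrected point agrees with an actual solution `X` on the selected matrices, hence on
    -- their span, which contains every `a t k`.
    have hsub : Submodule.span ℝ (Set.range (a t ∘ J)) ≤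
        LinearMap.ker ((dotBilin r).flip (X₀ + ∑ j, c t j • a t (J j) - X)) := by
      rw [Submodule.span_le]
      rintro _ ⟨j, rfl⟩
      rw [SetLike.mem_coe, LinearMap.mem_ker, LinearMap.flip_apply, map_sub, dotBilin_apply,
        dotBilin_apply, Function.comp_apply, hsol, hX, sub_self]
    have := hsub hk
    rw [LinearMap.mem_ker, LinearMap.flip_apply, map_sub, dotBilin_apply, dotBilin_apply, hX,
      sub_eq_zero] at this
    exact this

/-! ### Feasible regions and their minimal faces -/

section

variable {n m : ℕ}

lemma dualFeasible_subset_psdCone (A : Fin m → Matrix (Fin n) (Fin n) ℝ) (b : Fin m → ℝ) :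
    dualFeasible A b ⊆ psdCone n := fun _ hX => hX.1

lemma isFace_dualMinimalFace (A : Fin m → Matrix (Fin n) (Fin n) ℝ) (b : Fin m → ℝ) :
    IsFace (psdCone n) (dualMinimalFace A b) :=
  isFace_minimalFace (convex_psdCone n) (dualFeasible_subset_psdCone A b)

/-- A facial reduction sequence remains valid for every problem whose coefficients have the same
combinations with respect to the multipliers of the sequence. -/
lemma dualFeasible_subset_of_facialReduction {A B : Fin m → Matrix (Fin n) (Fin n) ℝ}
    {b : Fin m → ℝ} {s : ℕ} {y : Fin s → Fin m → ℝ} {U V : Fin s → Matrix (Fin n) (Fin n) ℝ}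
    (hseq : IsFacialReductionSequence A b s y U V)
    (hB : ∀ i k, y i k • B k = y i k • A k) :
    dualFeasible B b ⊆ dualMinimalFace A b := by
  obtain ⟨F, hF0, hcert, hF, hlast⟩ := hseq
  intro X hX
  rw [← hlast]
  have hsymm : X.IsSymm := isSymm_of_isHermitian hX.1.isHermitian
  refine Fin.induction (motive := fun i => X ∈ F i) (hF0 ▸ hX.1) (fun i hi => ?_) (Fin.last s)
  obtain ⟨-, hV, hb, hUV, -⟩ := hcert i
  -- Feasibility gives `(U i + V i) • X = 0`, and `V i` vanishes on the current face, so `U i • X =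
  -- 0`.
  have h1 : dot (U i + V i) X = 0 := by
    rw [← hUV]
    have : dot (-∑ k, y i k • A k) X = -∑ k, b k * y i k := by
      simp_rw [← hB i, ← hX.2]
      simp [← dotBilin_apply, mul_comm]
    rw [this, hb, neg_zero]
  have h2 : dot (U i) X = 0 := by
    have h3 := hV.2 X hi
    simp only [← dotBilin_apply, map_add, LinearMap.add_apply] at h1 h3 ⊢
    linarith
  rw [hF i]
  refine ⟨hi, hsymm, ?_⟩
  rintro _ rfl
  rw [dot_comm, h2]

variable {p r : ℕ} (h : p + r = n)

/-- When the minimal face is a copy of the `r × r` positive semidefinite cone, some feasible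
matrix corresponds to a positive definite one. -/
lemma exists_posDef_feasible {A : Fin m → Matrix (Fin n) (Fin n) ℝ} {b : Fin m → ℝ}
    {Q : Matrix (Fin n) (Fin n) ℝ} (hQ : Q ∈ Matrix.orthogonalGroup (Fin n) ℝ)
    (hF : dualMinimalFace A b = faceMap h Q '' psdCone r)
    (hne : (dualFeasible A b).Nonempty) :
    ∃ X : Matrix (Fin r) (Fin r) ℝ, X.PosDef ∧ faceMap h Q X ∈ dualFeasible A b := by
  let S : Set (Matrix (Fin r) (Fin r) ℝ) := {X | X.PosSemidef ∧ faceMap h Q X ∈ dualFeasible A b}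
  have hlift : ∀ Y ∈ dualFeasible A b, ∃ X ∈ S, faceMap h Q X = Y := by
    intro Y hY
    have hYF : Y ∈ dualMinimalFace A b := subset_minimalFace _ _ hY
    rw [hF] at hYF
    obtain ⟨X, hX, rfl⟩ := hYF
    exact ⟨X, ⟨hX, hY⟩, rfl⟩
  have hS : S.Nonempty := by
    obtain ⟨Y, hY⟩ := hne
    obtain ⟨X, hX, -⟩ := hlift Y hY
    exact ⟨X, hX⟩
  let f : Matrix (Fin r) (Fin r) ℝ → ℕ := fun X => Module.finrank ℝ (LinearMap.ker X.mulVecLin)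
  -- Take `X` with kernel of least dimension; a degenerate direction `v` will contradict this
  -- choice.
  obtain ⟨X, ⟨hX, hXf⟩, hmin⟩ := exists_minimalFor_of_wellFoundedLT (· ∈ S) f hS
  refine ⟨X, ?_, hXf⟩
  refine PosDef.of_dotProduct_mulVec_pos hX.isHermitian fun v hv => ?_
  by_contra hle
  have hv0 : quadForm v X = 0 :=
    le_antisymm (by simpa [quadForm_apply] using hle) (quadForm_nonneg v hX)
  -- The form at `v`, extended to the ambient space so that its zero set cuts out a face of the
  -- large cone.
  let q : Matrix (Fin n) (Fin n) ℝ →ₗ[ℝ] ℝ :=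
    { toFun := fun Y => quadForm v (lowerRight h (Qᵀ * Y * Q))
      map_add' := fun Y Z => by
        rw [Matrix.mul_add, Matrix.add_mul, lowerRight_add, map_add]
      map_smul' := fun c Y => by
        rw [Matrix.mul_smul, Matrix.smul_mul, lowerRight_smul, map_smul, RingHom.id_apply] }
  have hq : ∀ Y, q (faceMap h Q Y) = quadForm v Y := fun Y =>
    congrArg (quadForm v) (lowerRight_faceMap h hQ Y)
  have hq0 : ∀ Y ∈ psdCone n, 0 ≤ q Y := fun Y hY => by
    refine quadForm_nonneg v (posSemidef_lowerRight h ?_)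
    have := PosSemidef.conjTranspose_mul_mul_same hY Q
    rwa [Matrix.conjTranspose_eq_transpose_of_trivial] at this
  -- Otherwise the minimal face lies in the zero set of `q`, yet it contains the image of the
  -- identity, where `q` equals `v ⬝ᵥ v`.
  have hex : ∃ Y ∈ S, quadForm v Y ≠ 0 := by
    by_contra! hall
    have hsub : dualMinimalFace A b ⊆ {Y | Y ∈ psdCone n ∧ q Y = 0} := by
      refine minimalFace_subset (isFace_inter_ker (convex_psdCone n) q hq0) fun Y hY => ?_
      obtain ⟨Z, hZ, rfl⟩ := hlift Y hY
      exact ⟨hY.1, by rw [hq, hall Z hZ]⟩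
    have h1 : faceMap h Q 1 ∈ dualMinimalFace A b := hF ▸ ⟨1, PosSemidef.one, rfl⟩
    have h2 := (hsub h1).2
    rw [hq, quadForm_apply, Matrix.one_mulVec] at h2
    exact hv (dotProduct_self_eq_zero.1 h2)
  obtain ⟨Y, ⟨hY, hYf⟩, hYv⟩ := hex
  have hZ : (1 / 2 : ℝ) • X + (1 / 2 : ℝ) • Y ∈ S := by
    refine ⟨convex_psdCone r hX hY (by norm_num) (by norm_num) (by norm_num), ?_⟩
    rw [map_add, map_smul, map_smul]
    refine ⟨convex_psdCone n hXf.1 hYf.1 (by norm_num) (by norm_num) (by norm_num), fun k => ?_⟩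
    have h1 := hXf.2 k
    have h2 := hYf.2 k
    simp only [← dotBilin_apply, map_add, map_smul, smul_eq_mul] at h1 h2 ⊢
    rw [h1, h2]
    ring
  -- The kernel of the midpoint lies in that of `X` and loses `v`.
  have hlt : f ((1 / 2 : ℝ) • X + (1 / 2 : ℝ) • Y) < f X := by
    refine Submodule.finrank_lt_finrank_of_lt (lt_of_le_of_ne (fun w hw => ?_) fun heq => ?_)
    · have hw' : ((1 / 2 : ℝ) • X + (1 / 2 : ℝ) • Y) *ᵥ w = 0 := hw
      have h0 : quadForm w ((1 / 2 : ℝ) • X + (1 / 2 : ℝ) • Y) = 0 := by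
        rw [quadForm_apply, hw', dotProduct_zero]
      simp only [map_add, map_smul, smul_eq_mul] at h0
      have g₁ := quadForm_nonneg w hX
      have g₂ := quadForm_nonneg w hY
      exact mulVec_eq_zero_of_quadForm_eq_zero hX (by linarith)
    · have hvk : v ∈ LinearMap.ker X.mulVecLin := mulVec_eq_zero_of_quadForm_eq_zero hX hv0
      rw [← heq] at hvk
      have hv' : ((1 / 2 : ℝ) • X + (1 / 2 : ℝ) • Y) *ᵥ v = 0 := hvk
      have h0 : quadForm v ((1 / 2 : ℝ) • X + (1 / 2 : ℝ) • Y) = 0 := by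
        rw [quadForm_apply, hv', dotProduct_zero]
      simp only [map_add, map_smul, smul_eq_mul, hv0] at h0
      exact hYv (by linarith)
  exact absurd (hmin hZ hlt.le) (not_le.2 hlt)

/-- A face containing the image of a positive definite matrix contains the image of the whole
positive semidefinite cone. -/
lemma image_faceMap_subset_of_posDef_mem {Q : Matrix (Fin n) (Fin n) ℝ}
    {F : Set (Matrix (Fin n) (Fin n) ℝ)} (hF : IsFace (psdCone n) F)
    {X : Matrix (Fin r) (Fin r) ℝ} (hX : X.PosDef) (hXF : faceMap h Q X ∈ F) :
    faceMap h Q '' psdCone r ⊆ F := by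
  rintro _ ⟨Y, hY, rfl⟩
  have hXs : X.IsSymm := isSymm_of_isHermitian hX.isHermitian
  have hYs : Y.IsSymm := isSymm_of_isHermitian (PosSemidef.isHermitian hY)
  have ht : Tendsto (fun ε : ℝ => X - ε • Y) (𝓝[>] 0) (𝓝 X) := by
    have : Continuous fun ε : ℝ => X - ε • Y := by fun_prop
    simpa using (this.tendsto 0).mono_left nhdsWithin_le_nhds
  obtain ⟨ε, hε, hε0, hε1⟩ := ((ht.eventually (eventually_posDef hX)).and
    (Ioo_mem_nhdsGT one_pos)).exists
  have hpd : (X - ε • Y).PosDef := hε (hXs.sub (hYs.smul ε))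
  have hε' : 0 < 1 - ε := sub_pos.2 hε1
  have hZ : ((1 - ε)⁻¹ • (X - ε • Y)).PosSemidef :=
    PosSemidef.smul hpd.posSemidef (inv_nonneg.2 hε'.le)
  -- `X` is the combination of `Y` and `(1 - ε)⁻¹ • (X - ε • Y)` with weights `ε` and `1 - ε`, so
  -- the face property captures `Y`.
  refine (hF.2.2 _ (posSemidef_faceMap h Q hY) _ (posSemidef_faceMap h Q hZ)
    ⟨_, ⟨ε, 1 - ε, hε0, hε', by ring, rfl⟩, ?_⟩).1
  rw [← map_smul, ← map_smul, ← map_add, smul_inv_smul₀ hε'.ne', add_sub_cancel]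
  exact hXF

end

end SDPFace

theorem proposition4p1 {n m : ℕ}
    (A₀ : Matrix (Fin n) (Fin n) ℝ) (A : Fin m → Matrix (Fin n) (Fin n) ℝ) (b : Fin m → ℝ)
    (hA₀ : A₀.IsSymm) (hA : ∀ k, (A k).IsSymm)
    -- the perturbations: symmetric for `t ≥ 0`, vanishing at `0` and continuous there
    (E : Fin m → ℝ → Matrix (Fin n) (Fin n) ℝ)
    (hEsymm : ∀ k, ∀ t : ℝ, 0 ≤ t → (E k t).IsSymm)
    (hE0 : ∀ k, E k 0 = 0)
    (hEcont : ∀ k, ContinuousWithinAt (E k) (Set.Ici 0) 0)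
    -- a facial reduction sequence for the dual problem
    (s : ℕ) (y : Fin s → Fin m → ℝ) (U V : Fin s → Matrix (Fin n) (Fin n) ℝ)
    (hseq : IsFacialReductionSequence A b s y U V)
    (Khat : Set (Fin m)) (hKhat : Khat = {k | ∀ i, y i k = 0})
    -- feasibility of the dual, strict feasibility of the primal
    (hD1 : (dualFeasible A b).Nonempty ∧ PrimalStrictlyFeasible A₀ A)
    -- linear independence of the coefficient matrices
    (hD2 : LinearIndependent ℝ A)
    -- feasibility of the perturbed dual for small `t > 0`
    (hD3 : ∀ᶠ t : ℝ in 𝓝[>] 0, (dualFeasible (fun k => A k + E k t) b).Nonempty)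
    (hrank : RankCondition A b E)
    (hE : ∀ k, k ∉ Khat → ∀ t : ℝ, 0 ≤ t → E k t = 0) :
    ∀ᶠ t : ℝ in 𝓝[>] 0,
      dualMinimalFace (fun k => A k + E k t) b = dualMinimalFace A b := by
  obtain ⟨p, r, h, Q, hQ, hF, δ, hδ, hrk⟩ := hrank
  have hF' : dualMinimalFace A b = faceMap h Q '' psdCone r := by
    rw [hF]
    ext M
    simp only [Set.mem_ofPred_eq, Set.mem_image, faceMap_apply, eq_comm]
  have hsub : ∀ t : ℝ, 0 ≤ t →
      dualFeasible (fun k => A k + E k t) b ⊆ dualMinimalFace A b := by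
    intro t ht
    refine dualFeasible_subset_of_facialReduction hseq fun i k => ?_
    by_cases hk : k ∈ Khat
    · rw [hKhat] at hk
      rw [hk i, zero_smul, zero_smul]
    · rw [hE k hk t ht, add_zero]
  obtain ⟨X₀, hX₀, hX₀f⟩ := exists_posDef_feasible h hQ hF' hD1.1
  have hpos : ∀ᶠ t : ℝ in 𝓝[>] 0, 0 < t := self_mem_nhdsWithin
  obtain ⟨x, hx, hxs, hxf⟩ := exists_tendsto_solution (l := 𝓝[>] (0 : ℝ))
    (fun t k => lowerRight h (Qᵀ * (A k + E k t) * Q)) (fun k => lowerRight h (Qᵀ * A k * Q)) b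
    (fun k => by
      have h1 : Tendsto (E k) (𝓝[>] 0) (𝓝 0) := by
        have := (hEcont k).mono_left (nhdsWithin_mono _ Set.Ioi_subset_Ici_self)
        rwa [hE0] at this
      have h2 : Continuous fun B : Matrix (Fin n) (Fin n) ℝ =>
          lowerRight h (Qᵀ * (A k + B) * Q) :=
        (continuous_lowerRight h).comp (by fun_prop)
      simpa [Function.comp_def] using (h2.tendsto 0).comp h1)
    (by
      filter_upwards [hpos, nhdsWithin_le_nhds (Iic_mem_nhds hδ)] with t ht htδ
      exact hrk t ht.le htδ)
    (by
      -- Perturbed feasible points lie in the unperturbed minimal face, so their coordinates solve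
      -- the restricted system.
      filter_upwards [hpos, hD3] with t ht ⟨Y, hY⟩
      have hYF := hsub t ht.le hY
      rw [hF'] at hYF
      obtain ⟨X, -, rfl⟩ := hYF
      exact ⟨X, fun k => by rw [← dot_faceMap]; exact hY.2 k⟩)
    X₀ (fun k => by rw [← dot_faceMap]; exact hX₀f.2 k)
  filter_upwards [hpos, hxf, hx.eventually (eventually_posDef hX₀)] with t ht hft hpd
  -- The correction lies in the span of symmetric matrices; symmetry is needed to apply openness of
  -- positive definiteness.
  have hsymm : (x t).IsSymm := by
    have hle : Submodule.span ℝ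
        (Set.range fun k => lowerRight h (Qᵀ * (A k + E k t) * Q)) ≤
        LinearMap.ker ((Matrix.transposeLinearEquiv (Fin r) (Fin r) ℝ ℝ).toLinearMap -
          LinearMap.id) := by
      rw [Submodule.span_le]
      rintro _ ⟨k, rfl⟩
      have hs : (Qᵀ * (A k + E k t) * Q).IsSymm := by
        rw [Matrix.IsSymm, Matrix.transpose_mul, Matrix.transpose_mul, Matrix.transpose_transpose,
          ((hA k).add (hEsymm k t ht.le)).eq, Matrix.mul_assoc]
      simpa [sub_eq_zero] using (isSymm_lowerRight h hs).eq
    have h1 : (x t - X₀).IsSymm := by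
      have := hle (hxs t)
      rwa [LinearMap.mem_ker, LinearMap.sub_apply, sub_eq_zero] at this
    have h2 : X₀.IsSymm := isSymm_of_isHermitian hX₀.isHermitian
    simpa using h1.add h2
  have hxpd := hpd hsymm
  have hfeas : faceMap h Q (x t) ∈ dualFeasible (fun k => A k + E k t) b :=
    ⟨posSemidef_faceMap h Q hxpd.posSemidef, fun k => by rw [dot_faceMap]; exact hft k⟩
  refine Set.Subset.antisymm
    (minimalFace_subset (isFace_dualMinimalFace A b) (hsub t ht.le)) ?_
  rw [hF']
  exact image_faceMap_subset_of_posDef_mem h (isFace_dualMinimalFace _ b) hxpd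
    (subset_minimalFace _ _ hfeas)
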